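/- Let $G$ be a finite group and let $\mathrm{Set}^G$ be the category of finite $G$-sets. An indexing category is a wide, pullback-stable, finite coproduct complete subcategory $\mathcal{O}\subseteq \mathrm{Set}^G$ (it contains all objects, is closed under pullback along arbitrary maps, and has finite coproducts, which are those of $\mathrm{Set}^G$). A $G$-transfer system is a partial order $\leq_{\mathcal{T}}$ on the set of subgroups of $G$ that refines inclusion and is closed under conjugation and under intersection (if $K\leq_{\mathcal{T}}H$, then $K\cap L\leq_{\mathcal{T}}H\cap L$ for all $L\leq G$). The transfer system $\mathcal{T}$ associated to an indexing category $\mathcal{O}$ is given by: $K\leq_{\mathcal{T}}H$ if and only if $K\leq H$ and the canonical projection $G/K\to G/H$ is a map in $\mathcal{O}$. For a map $n\colon S\to T$ of finite $G$-sets, let $n_*\colon \mathrm{Set}^G_{/S}\to\mathrm{Set}^G_{/T}$ be the dependent product, i.e. the right adjoint of the pullback functor $n^*$. Let $(\mathcal{O}_m,\mathcal{O}_a)$ be a pair of indexing categories with associated pair of transfer systems $(\mathcal{T}_m,\mathcal{T}_a)$. Then the following are equivalent. (a) $(\mathcal{O}_m,\mathcal{O}_a)$ is compatible: for every map $n\colon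 S\to T$ in $\mathcal{O}_m$ and every map $A\to S$ in $\mathcal{O}_a$, the structure map $n_*(A)\to T$ is in $\mathcal{O}_a$. (b) $(\mathcal{T}_m,\mathcal{T}_a)$ is compatible: $\mathcal{T}_m\leq\mathcal{T}_a$ (that is, $K\leq_{\mathcal{T}_m}H$ implies $K\leq_{\mathcal{T}_a}H$), and for all subgroups $A\leq G$ and $B,C\leq A$ with $B\leq_{\mathcal{T}_m}A$ and $B\cap C\leq_{\mathcal{T}_a}B$ one has $C\leq_{\mathcal{T}_a}A$. -/

import Mathlib

open CategoryTheory Limits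

universe u

/-- The category of finite `G`-sets and equivariant maps. -/
abbrev FinGSet (G : Type u) [Group G] : Type (u + 1) := Action FintypeCat.{u} G

namespace FinGSet

variable {G : Type u} [Group G]

/-- Build an equivariant map from a function commuting with the actions. -/
def homMk {X Y : FinGSet G} (f : X.V → Y.V) (hf : ∀ (g : G) (x : X.V), f (g • x) = g • f x) :
    X ⟶ Y where
  hom := FintypeCat.homMk f
  comm g := by
    ext x
    exact hf g x

theorem homMk_apply {X Y : FinGSet G} (f : X.V → Y.V)
    (hf : ∀ (g : G) (x : X.V), f (g • x) = g • f x) (x : X.V) : (homMk f hf).hom x = f x := rfl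

theorem hom_smul {X Y : FinGSet G} (f : X ⟶ Y) (g : G) (x : X.V) :
    f.hom (g • x) = g • f.hom x :=
  ConcreteCategory.congr_hom (f.comm g) x

theorem hom_ext' {X Y : FinGSet G} {f f' : X ⟶ Y} (h : ∀ x, f.hom x = f'.hom x) : f = f' := by
  apply Action.hom_ext
  ext x
  exact h x

theorem mono_of_injective {X Y : FinGSet G} (f : X ⟶ Y) (hf : Function.Injective f.hom) :
    Mono f :=
  ConcreteCategory.mono_of_injective f hf

/-- The finite `G`-set given by an action on a finite type. -/
def of (X : Type u) [Finite X] [MulAction G X] : FinGSet G :=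
  letI : MulAction G (FintypeCat.of X) := inferInstanceAs (MulAction G X)
  Action.FintypeCat.ofMulAction G (FintypeCat.of X)

theorem of_smul (X : Type u) [Finite X] [MulAction G X] (g : G) (x : X) :
    (g • (show (of (G := G) X).V from x)) = (show (of (G := G) X).V from g • x) := rfl

/-- The orbit `G/H` as a finite `G`-set. -/
def orbit [Finite G] (H : Subgroup G) : FinGSet G := of (G ⧸ H)

/-- The canonical projection `G/K → G/H`, `gK ↦ gH`, for `K ≤ H`. -/
def orbitMap [Finite G] {K H : Subgroup G} (h : K ≤ H) : orbit K ⟶ orbit H :=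
  homMk (Subgroup.quotientMapOfLE h) (by
    rintro g ⟨x⟩
    rfl)

/-- The equivariant bijection `G/gHg⁻¹ → G/H`, `x(gHg⁻¹) ↦ xgH`. -/
def orbitConj [Finite G] (H : Subgroup G) (g : G) :
    orbit (H.map (MulAut.conj g).toMonoidHom) ⟶ orbit H :=
  homMk (Quotient.lift (fun x : G => ((x * g : G) : G ⧸ H)) (by
    intro x y hxy
    obtain ⟨k, hk, e⟩ := QuotientGroup.leftRel_apply.mp hxy
    have e' : g * k * g⁻¹ = x⁻¹ * y := e
    refine QuotientGroup.eq.mpr ?_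
    have : (x * g)⁻¹ * (y * g) = k := by
      rw [mul_inv_rev, mul_assoc, ← mul_assoc x⁻¹, ← e']
      group
    rw [this]
    exact hk)) (by
    rintro h ⟨x⟩
    exact congrArg (fun y : G => (y : G ⧸ H)) (mul_assoc h x g))

theorem orbitConj_injective [Finite G] (H : Subgroup G) (g : G) :
    Function.Injective (orbitConj H g).hom := by
  rintro ⟨x⟩ ⟨y⟩ h
  have h' : (x * g)⁻¹ * (y * g) ∈ H := QuotientGroup.eq.mp h
  refine QuotientGroup.eq.mpr ⟨_, h', ?_⟩
  change g * ((x * g)⁻¹ * (y * g)) * g⁻¹ = x⁻¹ * y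
  group

/-! ### Dependent products -/

section DependentProduct

variable {S T : FinGSet G} (n : S ⟶ T)

/-- For `Y → S` and `n : S → T`, a pair `(t, A)` with `t ∈ T` and `A ⊆ Y` is (the image of) a
section of `Y → S` over the fibre `n⁻¹(t)`: the map `Y → S` sends `A` bijectively onto `n⁻¹(t)`. -/
def IsSection (Y : Over S) (p : T.V × Set Y.left.V) : Prop :=
  (∀ y ∈ p.2, n.hom (Y.hom.hom y) = p.1) ∧
    ∀ s : S.V, n.hom s = p.1 → ∃! y, y ∈ p.2 ∧ Y.hom.hom y = s

/-- Pairs of a point `t` of `T` and a section of `Y → S` over `n⁻¹(t)`. -/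
def Sections (Y : Over S) : Type u := {p : T.V × Set Y.left.V // IsSection n Y p}

instance (Y : Over S) : Finite (Sections n Y) := by
  unfold Sections
  infer_instance

theorem isSection_smul {Y : Over S} (g : G) {p : T.V × Set Y.left.V} (hp : IsSection n Y p) :
    IsSection n Y (g • p.1, {y | g⁻¹ • y ∈ p.2}) := by
  refine ⟨fun y hy => ?_, fun s hs => ?_⟩
  · have h := hp.1 _ hy
    rw [hom_smul, hom_smul] at h
    simp only [← h, smul_inv_smul]
  · obtain ⟨y, ⟨hy, hys⟩, hu⟩ := hp.2 (g⁻¹ • s) (by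
      rw [hom_smul, show n.hom s = g • p.1 from hs, inv_smul_smul])
    refine ⟨g • y, ⟨?_, ?_⟩, ?_⟩
    · simpa using hy
    · rw [hom_smul, hys, smul_inv_smul]
    · rintro z ⟨hz, hzs⟩
      have := hu (g⁻¹ • z) ⟨hz, by rw [hom_smul, hzs]⟩
      rw [← this, smul_inv_smul]

instance (Y : Over S) : MulAction G (Sections n Y) where
  smul g p := ⟨(g • p.1.1, {y | g⁻¹ • y ∈ p.1.2}), isSection_smul n g p.2⟩
  one_smul p := by
    apply Subtype.ext
    refine Prod.ext (one_smul G p.1.1) ?_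
    ext y
    change (1 : G)⁻¹ • y ∈ p.1.2 ↔ y ∈ p.1.2
    simp
  mul_smul g h p := by
    apply Subtype.ext
    refine Prod.ext (mul_smul g h p.1.1) ?_
    ext y
    change (g * h)⁻¹ • y ∈ p.1.2 ↔ h⁻¹ • g⁻¹ • y ∈ p.1.2
    rw [mul_inv_rev, mul_smul]

/-- The finite `G`-set of pairs of a point of `T` and a section over its fibre, over `T`. -/
def sectionsOver (Y : Over S) : Over T :=
  Over.mk (Y := of (G := G) (Sections n Y)) (homMk (fun p : Sections n Y => p.1.1) fun _ _ => rfl)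

theorem pullback_condition_apply {X : Over T} (z : (pullback X.hom n).V) :
    X.hom.hom ((pullback.fst X.hom n).hom z) = n.hom ((pullback.snd X.hom n).hom z) :=
  congrArg (fun f : pullback X.hom n ⟶ T => f.hom z) pullback.condition

theorem pullback_exists {X : Over T} (x : X.left.V) (s : S.V) (h : X.hom.hom x = n.hom s) :
    ∃ z : (pullback X.hom n).V,
      (pullback.fst X.hom n).hom z = x ∧ (pullback.snd X.hom n).hom z = s :=
  ⟨Concrete.pullbackMk (C := FinGSet G) X.hom n x s h,
    Concrete.pullbackMk_fst (C := FinGSet G) X.hom n x s h,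
    Concrete.pullbackMk_snd (C := FinGSet G) X.hom n x s h⟩

theorem pullback_ext {X : Over T} {z w : (pullback X.hom n).V}
    (h₁ : (pullback.fst X.hom n).hom z = (pullback.fst X.hom n).hom w)
    (h₂ : (pullback.snd X.hom n).hom z = (pullback.snd X.hom n).hom w) : z = w := by
  obtain ⟨x₁, x₂, h, rfl⟩ := Concrete.pullbackMk_surjective (C := FinGSet G) X.hom n z
  obtain ⟨y₁, y₂, h', rfl⟩ := Concrete.pullbackMk_surjective (C := FinGSet G) X.hom n w
  have e₁ : x₁ = y₁ := ((Concrete.pullbackMk_fst (C := FinGSet G) X.hom n x₁ x₂ h).symm.trans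
    h₁).trans (Concrete.pullbackMk_fst (C := FinGSet G) X.hom n y₁ y₂ h')
  have e₂ : x₂ = y₂ := ((Concrete.pullbackMk_snd (C := FinGSet G) X.hom n x₁ x₂ h).symm.trans
    h₂).trans (Concrete.pullbackMk_snd (C := FinGSet G) X.hom n y₁ y₂ h')
  subst e₁ e₂
  rfl

theorem over_w_apply {Z : FinGSet G} {X Y : Over Z} (φ : X ⟶ Y) (x : X.left.V) :
    Y.hom.hom (φ.left.hom x) = X.hom.hom x :=
  congrArg (fun f : X.left ⟶ Z => f.hom x) (Over.w φ)

theorem pullback_w_apply {X : Over T} {Y : Over S} (φ : (Over.pullback n).obj X ⟶ Y)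
    (z : (pullback X.hom n).V) :
    Y.hom.hom (φ.left.hom z) = (pullback.snd X.hom n).hom z :=
  over_w_apply φ z

/-- The section of `Y → S` attached to a point `x` of `X` and a map `n^* X → Y` over `S`. -/
def transposeSet {X : Over T} {Y : Over S} (φ : (Over.pullback n).obj X ⟶ Y) (x : X.left.V) :
    Set Y.left.V :=
  {y | ∃ z : (pullback X.hom n).V, (pullback.fst X.hom n).hom z = x ∧ φ.left.hom z = y}

theorem isSection_transposeSet {X : Over T} {Y : Over S} (φ : (Over.pullback n).obj X ⟶ Y)
    (x : X.left.V) : IsSection n Y (X.hom.hom x, transposeSet n φ x) := by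
  refine ⟨?_, fun s hs => ?_⟩
  · rintro y ⟨z, rfl, rfl⟩
    rw [pullback_w_apply, pullback_condition_apply]
  · obtain ⟨z, hz₁, hz₂⟩ := pullback_exists n x s hs.symm
    refine ⟨φ.left.hom z, ⟨⟨z, hz₁, rfl⟩, (pullback_w_apply n φ z).trans hz₂⟩, ?_⟩
    rintro _ ⟨⟨w, hw₁, rfl⟩, hw₂⟩
    rw [pullback_w_apply] at hw₂
    rw [pullback_ext n (hw₁.trans hz₁.symm) (hw₂.trans hz₂.symm)]

theorem transposeSet_smul {X : Over T} {Y : Over S} (φ : (Over.pullback n).obj X ⟶ Y)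
    (g : G) (x : X.left.V) :
    transposeSet n φ (g • x) = {y | g⁻¹ • y ∈ transposeSet n φ x} := by
  ext y
  constructor
  · rintro ⟨z, hz, rfl⟩
    exact ⟨g⁻¹ • z, by rw [hom_smul, hz, inv_smul_smul], hom_smul φ.left g⁻¹ z⟩
  · rintro ⟨z, hz, hy⟩
    exact ⟨g • z, by rw [hom_smul, hz], (hom_smul φ.left g z).trans (by rw [hy, smul_inv_smul])⟩

/-- The transpose of `φ : n^* X ⟶ Y`: a point `x` of `X` over `t` is sent to the section
`s ↦ φ (x, s)` over `n⁻¹(t)`. -/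
def transpose {X : Over T} {Y : Over S} (φ : (Over.pullback n).obj X ⟶ Y) :
    X ⟶ sectionsOver n Y :=
  Over.homMk
    (homMk (Y := of (G := G) (Sections n Y))
      (fun x : X.left.V =>
        (⟨(X.hom.hom x, transposeSet n φ x), isSection_transposeSet n φ x⟩ : Sections n Y))
      (fun g x => Subtype.ext (Prod.ext (hom_smul X.hom g x) (transposeSet_smul n φ g x))))
    rfl

/-- The underlying pair of a point of `sectionsOver n Y`. -/
def val {Y : Over S} (p : (sectionsOver n Y).left.V) : T.V × Set Y.left.V :=
  (show Sections n Y from p).1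

theorem val_injective {Y : Over S} : Function.Injective (val n (Y := Y)) := Subtype.val_injective

theorem val_isSection {Y : Over S} (p : (sectionsOver n Y).left.V) : IsSection n Y (val n p) :=
  (show Sections n Y from p).2

theorem val_smul {Y : Over S} (g : G) (p : (sectionsOver n Y).left.V) :
    val n (g • p) = (g • (val n p).1, {y | g⁻¹ • y ∈ (val n p).2}) := rfl

theorem val_transpose {X : Over T} {Y : Over S} (φ : (Over.pullback n).obj X ⟶ Y)
    (x : X.left.V) :
    val n ((transpose n φ).left.hom x) = (X.hom.hom x, transposeSet n φ x) := rfl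

theorem transpose_injective (X : Over T) (Y : Over S) :
    Function.Injective (transpose n : ((Over.pullback n).obj X ⟶ Y) → _) := by
  intro φ φ' h
  apply Over.OverMorphism.ext
  apply hom_ext'
  intro (z : (pullback X.hom n).V)
  have key : transposeSet n φ ((pullback.fst X.hom n).hom z) =
      transposeSet n φ' ((pullback.fst X.hom n).hom z) := by
    have := congrArg (fun ψ : X ⟶ sectionsOver n Y =>
      (val n (ψ.left.hom ((pullback.fst X.hom n).hom z))).2) h
    exact this
  have hz : φ.left.hom z ∈ transposeSet n φ ((pullback.fst X.hom n).hom z) := ⟨z, rfl, rfl⟩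
  rw [key] at hz
  obtain ⟨w, hw₁, hw₂⟩ := hz
  have : w = z := by
    refine pullback_ext n hw₁ ?_
    rw [← pullback_w_apply n φ', ← pullback_w_apply n φ, hw₂]
  rw [← hw₂, this]

theorem transpose_surjective (X : Over T) (Y : Over S) :
    Function.Surjective (transpose n : ((Over.pullback n).obj X ⟶ Y) → _) := by
  intro ψ
  have hψ (x : X.left.V) : (val n (ψ.left.hom x)).1 = X.hom.hom x := over_w_apply ψ x
  have hex (z : (pullback X.hom n).V) :
      ∃! y, y ∈ (val n (ψ.left.hom ((pullback.fst X.hom n).hom z))).2 ∧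
        Y.hom.hom y = (pullback.snd X.hom n).hom z :=
    (val_isSection n _).2 _ (by rw [hψ, pullback_condition_apply])
  choose f hf hu using hex
  have hsmul (g : G) (z : (pullback X.hom n).V) : f (g • z) = g • f z := by
    refine (hu (g • z) (g • f z) ⟨?_, ?_⟩).symm
    · rw [hom_smul, hom_smul, val_smul]
      simpa using (hf z).1
    · rw [hom_smul, hom_smul, (hf z).2]
  let φ : (Over.pullback n).obj X ⟶ Y :=
    Over.homMk (homMk (X := pullback X.hom n) f hsmul) (hom_ext' fun z => (hf z).2)
  refine ⟨φ, Over.OverMorphism.ext (hom_ext' fun x => val_injective n ?_)⟩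
  rw [val_transpose]
  refine Prod.ext (hψ x).symm ?_
  ext y
  constructor
  · rintro ⟨z, rfl, rfl⟩
    exact (hf z).1
  · intro hy
    obtain ⟨z, hz₁, hz₂⟩ := pullback_exists n x (Y.hom.hom y)
      ((hψ x).symm.trans ((val_isSection n _).1 y hy).symm)
    refine ⟨z, hz₁, (hu z y ⟨?_, hz₂.symm⟩).symm⟩
    rw [hz₁]
    exact hy

theorem transpose_naturality (X' X : Over T) (Y : Over S) (f : X' ⟶ X)
    (φ : (Over.pullback n).obj X ⟶ Y) :
    transpose n ((Over.pullback n).map f ≫ φ) = f ≫ transpose n φ := by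
  refine Over.OverMorphism.ext (hom_ext' fun x => val_injective n ?_)
  refine Prod.ext (over_w_apply f x).symm ?_
  have hfst (z : (pullback X'.hom n).V) :
      (pullback.fst X.hom n).hom (((Over.pullback n).map f).left.hom z) =
        f.left.hom ((pullback.fst X'.hom n).hom z) := by
    have : ((Over.pullback n).map f).left ≫ pullback.fst X.hom n =
        pullback.fst X'.hom n ≫ f.left := pullback.lift_fst _ _ _
    exact congrArg (fun k : pullback X'.hom n ⟶ X.left => k.hom z) this
  change transposeSet n ((Over.pullback n).map f ≫ φ) x = transposeSet n φ (f.left.hom x)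
  ext y
  constructor
  · rintro ⟨z, rfl, rfl⟩
    exact ⟨((Over.pullback n).map f).left.hom z, hfst z, rfl⟩
  · rintro ⟨w, hw, rfl⟩
    obtain ⟨z, hz₁, hz₂⟩ := pullback_exists n x ((pullback.snd X.hom n).hom w) (by
      rw [← pullback_condition_apply, hw, over_w_apply])
    refine ⟨z, hz₁, ?_⟩
    have : ((Over.pullback n).map f).left.hom z = w := by
      refine pullback_ext n ?_ ?_
      · rw [hfst, hz₁, hw]
      · exact (over_w_apply ((Over.pullback n).map f) z).trans hz₂
    change φ.left.hom (((Over.pullback n).map f).left.hom z) = φ.left.hom w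
    rw [this]

/-- The functor `Y ↦ sectionsOver n Y` is right adjoint to pullback along `n`. -/
noncomputable def pullbackAdjunction :
    Over.pullback n ⊣ Adjunction.rightAdjointOfEquiv (F := Over.pullback n)
      (G_obj := sectionsOver n)
      (fun X Y => Equiv.ofBijective (transpose n)
        ⟨transpose_injective n X Y, transpose_surjective n X Y⟩)
      (transpose_naturality n) :=
  Adjunction.adjunctionOfEquivRight _ _

instance : (Over.pullback n).IsLeftAdjoint := (pullbackAdjunction n).isLeftAdjoint

/-- The dependent product along `n : S ⟶ T`: the right adjoint of the pullback functor
`n^* : Over T ⥤ Over S`. -/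
noncomputable def dependentProduct : Over S ⥤ Over T := (Over.pullback n).rightAdjoint

end DependentProduct

end FinGSet

/-- An indexing category for `G`: a wide, pullback stable subcategory of the category of finite
`G`-sets (given by its class of morphisms) in which finite coproducts exist and are those of
finite `G`-sets. -/
structure IndexingCategory (G : Type u) [Group G] where
  /-- The morphisms of the subcategory. -/
  hom : MorphismProperty (FinGSet G)
  id_mem (X : FinGSet G) : hom (𝟙 X)
  comp_mem {X Y Z : FinGSet G} (f : X ⟶ Y) (g : Y ⟶ Z) : hom f → hom g → hom (f ≫ g)
  pullback_mem {X' X Y' Y : FinGSet G} {f' : X' ⟶ X} {g' : X' ⟶ Y'} {g : X ⟶ Y} {f : Y' ⟶ Y} :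
    IsPullback f' g' g f → hom g → hom g'
  coprod_inj_mem {J : Type} [Finite J] {F : J → FinGSet G} (c : Cofan F) :
    IsColimit c → ∀ j, hom (c.inj j)
  coprod_desc_mem {J : Type} [Finite J] {F : J → FinGSet G} (c : Cofan F) :
    IsColimit c → ∀ {Z : FinGSet G} (f : c.pt ⟶ Z), (∀ j, hom (c.inj j ≫ f)) → hom f

/-- A `G`-transfer system: a partial order on the subgroups of `G` that refines inclusion and is
closed under conjugation and under intersection. -/
structure TransferSystem (G : Type u) [Group G] where
  rel : Subgroup G → Subgroup G → Prop
  refl (H : Subgroup G) : rel H H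
  antisymm {H K : Subgroup G} : rel H K → rel K H → H = K
  trans {L K H : Subgroup G} : rel L K → rel K H → rel L H
  le_of_rel {K H : Subgroup G} : rel K H → K ≤ H
  conj {K H : Subgroup G} (g : G) :
    rel K H → rel (K.map (MulAut.conj g).toMonoidHom) (H.map (MulAut.conj g).toMonoidHom)
  inter {K H : Subgroup G} (L : Subgroup G) : rel K H → rel (K ⊓ L) (H ⊓ L)

namespace IndexingCategory

open FinGSet

variable {G : Type u} [Group G] (O : IndexingCategory G)

/-- All monomorphisms lie in an indexing category. -/
theorem mono_mem {X Y : FinGSet G} (i : X ⟶ Y) [Mono i] : O.hom i := by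
  obtain ⟨Z, u, ⟨hc⟩⟩ := PreGaloisCategory.monoInducesIsoOnDirectSummand i
  exact O.coprod_inj_mem (F := fun j => (pair X Z).obj ⟨j⟩)
    (show Cofan (fun j => (pair X Z).obj ⟨j⟩) from BinaryCofan.mk i u) hc
    WalkingPair.left

/-- A map that embeds into the pullback of a map of `O` lies in `O`. -/
theorem mem_of_square {X X' Y Y' : FinGSet G} {f : X ⟶ Y} {f' : X' ⟶ Y'} (a : X ⟶ X')
    (b : Y ⟶ Y') (w : a ≫ f' = f ≫ b)
    (inj : ∀ x₁ x₂ : X.V, a.hom x₁ = a.hom x₂ → f.hom x₁ = f.hom x₂ → x₁ = x₂)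
    (hf' : O.hom f') : O.hom f := by
  have hm : Mono (pullback.lift a f w) := by
    apply mono_of_injective
    intro x₁ x₂ h
    refine inj x₁ x₂ ?_ ?_
    · have := congrArg (pullback.fst f' b).hom h
      have e := pullback.lift_fst a f w
      rw [← e]
      exact this
    · have := congrArg (pullback.snd f' b).hom h
      have e := pullback.lift_snd a f w
      rw [← e]
      exact this
  have e := pullback.lift_snd a f w
  rw [← e]
  exact O.comp_mem _ _ (O.mono_mem _) (O.pullback_mem (IsPullback.of_hasPullback f' b) hf')

section

variable [Finite G]

/-- The relation on subgroups defined by `O`: `K ≤ H` and the canonical projection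
`G/K → G/H` lies in `O`, i.e. `H/K` is an `O`-admissible `H`-set. -/
def Admissible (K H : Subgroup G) : Prop := ∃ h : K ≤ H, O.hom (orbitMap h)

/-- The transfer system associated to an indexing category. -/
def transferSystem : TransferSystem G where
  rel := O.Admissible
  refl H := ⟨le_refl H, by
    have : orbitMap (le_refl H) = 𝟙 (orbit H) := hom_ext' (by rintro ⟨x⟩; rfl)
    rw [this]
    exact O.id_mem _⟩
  antisymm h₁ h₂ := le_antisymm h₁.1 h₂.1
  trans := by
    rintro L K H ⟨h₁, m₁⟩ ⟨h₂, m₂⟩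
    refine ⟨h₁.trans h₂, ?_⟩
    have : orbitMap (h₁.trans h₂) = orbitMap h₁ ≫ orbitMap h₂ := hom_ext' (by rintro ⟨x⟩; rfl)
    rw [this]
    exact O.comp_mem _ _ m₁ m₂
  le_of_rel h := h.1
  conj := by
    rintro K H g ⟨h, m⟩
    refine ⟨Subgroup.map_mono h, ?_⟩
    exact O.mem_of_square (orbitConj K g) (orbitConj H g) (hom_ext' (by rintro ⟨x⟩; rfl))
      (fun x₁ x₂ hx _ => orbitConj_injective K g hx) m
  inter := by
    rintro K H L ⟨h, m⟩
    refine ⟨inf_le_inf_right L h, ?_⟩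
    refine O.mem_of_square (orbitMap inf_le_left) (orbitMap inf_le_left)
      (hom_ext' (by rintro ⟨x⟩; rfl)) ?_ m
    rintro ⟨x₁⟩ ⟨x₂⟩ h₁ h₂
    have h₁' : x₁⁻¹ * x₂ ∈ K := QuotientGroup.eq.mp h₁
    have h₂' : x₁⁻¹ * x₂ ∈ H ⊓ L := QuotientGroup.eq.mp h₂
    exact QuotientGroup.eq.mpr ⟨h₁', h₂'.2⟩

end

/-- A pair `(O_m, O_a)` of indexing categories is compatible if, for every map `n : S ⟶ T` in
`O_m`, the dependent product along `n` sends objects `A → S` over `S` whose structure map is in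
`O_a` to objects over `T` whose structure map is in `O_a`. -/
def Compatible (Om Oa : IndexingCategory G) : Prop :=
  ∀ ⦃S T : FinGSet G⦄ (n : S ⟶ T), Om.hom n →
    ∀ A : Over S, Oa.hom A.hom → Oa.hom ((dependentProduct n).obj A).hom

end IndexingCategory

namespace TransferSystem

variable {G : Type u} [Group G]

/-- `T₁ ≤ T₂` if the relation of `T₁` implies that of `T₂`. -/
instance : LE (TransferSystem G) := ⟨fun T₁ T₂ => ∀ K H : Subgroup G, T₁.rel K H → T₂.rel K H⟩

/-- Compatibility of a pair of transfer systems. -/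
def Compatible (T₁ T₂ : TransferSystem G) : Prop :=
  T₁ ≤ T₂ ∧
    ∀ A B C : Subgroup G, B ≤ A → C ≤ A → T₁.rel B A → T₂.rel (B ⊓ C) B → T₂.rel C A

end TransferSystem

/-! Both conditions reduce to statements about stabilizers. A finite `G`-set is the coproduct of its
orbits, and an indexing category contains all monomorphisms, so `f` lies in `O` exactly when `Gₓ →
G_{f x}` is admissible for every point `x` (`hom_iff_stabilizer`). By uniqueness of adjoints, the
dependent product may be replaced by the explicit `G`-set of sections. For (b) ⇒ (a), the stabilizer
of a section must be admissible in that of its base point; `rel_stabilizer_section_inf` shows this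
by induction on the subgroups `L` fixing the base point. If `L` fixes the fibre of `n` pointwise,
the stabilizer in `L` is a finite intersection of admissible subgroups. Otherwise compatibility
passes from the smaller group `Gₛ ∩ L` up to `L`. For (a) ⇒ (b), the dependent product of `G/(B ∩ C)
⊔ G/B` along `G/B → G/A` contains a section with stabilizer `C` over a point with stabilizer `A`. -/

namespace FinGSet

variable {G : Type u} [Group G]

/-! ### Orbit decompositions of finite `G`-sets -/

/-- A cofan of finite `G`-sets whose injections are jointly bijective is a coproduct. -/
noncomputable def isColimitOfBijective {J : Type} {F : J → FinGSet G} (c : Cofan F)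
    (h : ∀ x : c.pt.V, ∃! p : Σ j, (F j).V, (c.inj p.1).hom p.2 = x) : IsColimit c := by
  choose p hp hu using h
  have hinj (j : J) (y : (F j).V) : p ((c.inj j).hom y) = ⟨j, y⟩ := (hu _ ⟨j, y⟩ rfl).symm
  have hsmul (g : G) (x : c.pt.V) : p (g • x) = ⟨(p x).1, g • (p x).2⟩ := by
    refine (hu _ ⟨(p x).1, g • (p x).2⟩ ?_).symm
    exact (hom_smul _ _ _).trans (congrArg (g • ·) (hp x))
  refine Cofan.IsColimit.mk c
    (fun s => homMk (fun x => (s.inj (p x).1).hom (p x).2) fun g x => ?_)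
    (fun s j => hom_ext' fun y => ?_) (fun s m hm => hom_ext' fun x => ?_)
  · have := congrArg (fun q : Σ j, (F j).V => (s.inj q.1).hom q.2) (hsmul g x)
    exact this.trans (hom_smul _ _ _)
  · exact congrArg (fun q : Σ j, (F j).V => (s.inj q.1).hom q.2) (hinj j y)
  · have h₁ : m.hom ((c.inj (p x).1).hom (p x).2) = (s.inj (p x).1).hom (p x).2 :=
      congrArg (fun f : F (p x).1 ⟶ s.pt => f.hom (p x).2) (hm (p x).1)
    rw [hp x] at h₁
    exact h₁

theorem stabilizer_le_of_hom {X Y : FinGSet G} (f : X ⟶ Y) (x : X.V) :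
    MulAction.stabilizer G x ≤ MulAction.stabilizer G (f.hom x) := by
  intro g hg
  rw [MulAction.mem_stabilizer_iff] at hg ⊢
  rw [← hom_smul, hg]

variable [Finite G]

/-- The inclusion `G/Gₓ → X` of the orbit of `x`. -/
def orbitInclusion {X : FinGSet G} (x : X.V) : orbit (MulAction.stabilizer G x) ⟶ X :=
  homMk (MulAction.ofQuotientStabilizer G x) (MulAction.ofQuotientStabilizer_smul G x)

theorem orbitInclusion_injective {X : FinGSet G} (x : X.V) :
    Function.Injective (orbitInclusion x).hom :=
  MulAction.injective_ofQuotientStabilizer G x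

theorem orbitMap_orbitInclusion {X Y : FinGSet G} (f : X ⟶ Y) (x : X.V) :
    orbitMap (stabilizer_le_of_hom f x) ≫ orbitInclusion (f.hom x) = orbitInclusion x ≫ f :=
  hom_ext' (by
    rintro ⟨g⟩
    exact (hom_smul f g x).symm)

/-- A finite `G`-set is the coproduct of its orbits. -/
theorem exists_isColimit_orbits (X : FinGSet G) :
    ∃ (k : ℕ) (x : Fin k → X.V),
      Nonempty (IsColimit (Cofan.mk X fun j => orbitInclusion (x j))) := by
  obtain ⟨k, ⟨e⟩⟩ := Finite.exists_equiv_fin (MulAction.orbitRel.Quotient G X.V)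
  let q (x : X.V) : MulAction.orbitRel.Quotient G X.V := Quotient.mk'' x
  refine ⟨k, fun j => (e.symm j).out, ⟨isColimitOfBijective _ fun (x : X.V) => ?_⟩⟩
  have hx : x ∈ MulAction.orbit G (e.symm (e (q x))).out := by
    rw [← MulAction.orbitRel_apply, e.symm_apply_apply]
    exact (MulAction.orbitRel G X.V).symm (Quotient.mk_out (s := MulAction.orbitRel G X.V) x)
  obtain ⟨g, hg⟩ := hx
  refine ⟨⟨e (q x), (g : G ⧸ MulAction.stabilizer G (e.symm (e (q x))).out)⟩, hg, ?_⟩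
  rintro ⟨j, ⟨g'⟩⟩ hy
  have hy' : g' • (e.symm j).out = x := hy
  have hj : j = e (q x) := by
    rw [← e.symm_apply_eq, ← Quotient.out_eq (e.symm j)]
    exact Quotient.sound ((MulAction.orbitRel G X.V).symm
      (MulAction.orbitRel_apply.mpr ⟨g', hy'⟩))
  subst hj
  exact congrArg (Sigma.mk _) (orbitInclusion_injective _ (hy'.trans hg.symm))

theorem stabilizer_orbit_one (H : Subgroup G) :
    MulAction.stabilizer G (show (orbit H).V from ((1 : G) : G ⧸ H)) = H :=
  MulAction.stabilizer_quotient H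

end FinGSet

/-! ### Membership in an indexing category -/

namespace IndexingCategory

open FinGSet

variable {G : Type u} [Group G] (O : IndexingCategory G)

theorem hom_iff_of_iso {T : FinGSet G} {X Y : Over T} (e : X ≅ Y) : O.hom X.hom ↔ O.hom Y.hom := by
  constructor
  · intro h
    rw [← Over.w e.inv]
    exact O.comp_mem _ _ (O.mono_mem _) h
  · intro h
    rw [← Over.w e.hom]
    exact O.comp_mem _ _ (O.mono_mem _) h

/-- Right adjoints are unique up to isomorphism, so the abstract dependent product can be traded for
the concrete model. -/
theorem hom_dependentProduct_iff {S T : FinGSet G} (n : S ⟶ T) (Y : Over S) :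
    O.hom ((dependentProduct n).obj Y).hom ↔ O.hom (sectionsOver n Y).hom :=
  O.hom_iff_of_iso
    (((Adjunction.ofIsLeftAdjoint (Over.pullback n)).rightAdjointUniq (pullbackAdjunction n)).app Y)

variable [Finite G]

/-- Membership in an indexing category is detected by stabilizers. -/
theorem hom_iff_stabilizer {X Y : FinGSet G} (f : X ⟶ Y) :
    O.hom f ↔ ∀ x : X.V,
      O.Admissible (MulAction.stabilizer G x) (MulAction.stabilizer G (f.hom x)) := by
  refine ⟨fun hf x => ⟨stabilizer_le_of_hom f x, ?_⟩, fun h => ?_⟩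
  -- Since orbit inclusions are injective, the projection of orbits embeds into a pullback of `f`.
  · exact O.mem_of_square (orbitInclusion x) (orbitInclusion (f.hom x))
      (orbitMap_orbitInclusion f x).symm
      (fun _ _ e _ => orbitInclusion_injective x e) hf
  · obtain ⟨k, x, ⟨hc⟩⟩ := exists_isColimit_orbits X
    refine O.coprod_desc_mem _ hc f fun j => ?_
    have : Mono (orbitInclusion (f.hom (x j))) :=
      mono_of_injective _ (orbitInclusion_injective _)
    -- On each orbit, `f` is a canonical projection followed by a monomorphism.
    have e : (Cofan.mk X fun j => orbitInclusion (x j)).inj j ≫ f =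
        orbitMap (stabilizer_le_of_hom f (x j)) ≫ orbitInclusion (f.hom (x j)) :=
      (orbitMap_orbitInclusion f (x j)).symm
    rw [e]
    exact O.comp_mem _ _ (h (x j)).2 (O.mono_mem _)

end IndexingCategory

/-! ### Intersections of admissible subgroups -/

namespace TransferSystem

variable {G : Type u} [Group G] (T : TransferSystem G)

/-- Restricting `M ⊓ L → L` to `N ⊓ L` gives `M ⊓ N ⊓ L → N ⊓ L`, which composes with `N ⊓ L → L`.
-/
theorem rel_inf_of_rel {L M N : Subgroup G} (hM : T.rel (M ⊓ L) L) (hN : T.rel (N ⊓ L) L) :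
    T.rel ((M ⊓ N) ⊓ L) L := by
  have h := T.inter (N ⊓ L) hM
  rw [inf_eq_right.mpr (inf_le_right : N ⊓ L ≤ L), ← inf_inf_distrib_right] at h
  exact T.trans h hN

theorem rel_iInf_of_rel {ι : Type*} {L : Subgroup G} (s : Finset ι) (M : ι → Subgroup G)
    (h : ∀ i ∈ s, T.rel (M i ⊓ L) L) : T.rel ((⨅ i ∈ s, M i) ⊓ L) L := by
  classical
  induction s using Finset.induction_on with
  | empty => simpa using T.refl L
  | insert i s _ ih =>
    rw [Finset.iInf_insert]
    exact T.rel_inf_of_rel (h i (s.mem_insert_self i))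
      (ih fun j hj => h j (Finset.mem_insert_of_mem hj))

end TransferSystem

/-! ### Stabilizers of sections -/

namespace FinGSet

variable {G : Type u} [Group G] [Finite G]

/-- The stabilizer of a section is admissible in every subgroup fixing its base point. -/
theorem rel_stabilizer_section_inf {S T : FinGSet G} (n : S ⟶ T) (Y : Over S)
    {Tm Ta : TransferSystem G} (hc : Tm.Compatible Ta)
    (hn : ∀ s : S.V, Tm.rel (MulAction.stabilizer G s) (MulAction.stabilizer G (n.hom s)))
    (hY : ∀ y : Y.left.V,
      Ta.rel (MulAction.stabilizer G y) (MulAction.stabilizer G (Y.hom.hom y)))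
    (p : (sectionsOver n Y).left.V) (L : Subgroup G)
    (hL : L ≤ MulAction.stabilizer G (val n p).1) :
    Ta.rel (MulAction.stabilizer G p ⊓ L) L := by
  -- The case of interest is the full stabilizer of the base point; general `L` is there to make
  -- room for descent to smaller subgroups.
  induction L using WellFoundedLT.induction with
  | _ L ih =>
  obtain ⟨hp₁, hp₂⟩ := val_isSection n p
  by_cases hfix : ∀ s : S.V, n.hom s = (val n p).1 → L ≤ MulAction.stabilizer G s
  -- `L` preserves each fibre of `Y → S` over `n⁻¹(t)`, and the section meets each in one point.
  -- Hence an element of `L` fixes the section iff it fixes all its points.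
  · have key : MulAction.stabilizer G p ⊓ L =
        (⨅ y ∈ (Set.toFinite (val n p).2).toFinset, MulAction.stabilizer G y) ⊓ L := by
      have hmove {g : G} (hg : g ∈ L) {y : Y.left.V} (hy : y ∈ (val n p).2)
          (hgy : g • y ∈ (val n p).2) : g • y = y := by
        have hs := hp₁ y hy
        refine (hp₂ _ hs).unique ⟨hgy, ?_⟩ ⟨hy, rfl⟩
        rw [hom_smul]
        exact hfix _ hs hg
      ext g
      simp only [Subgroup.mem_inf, Subgroup.mem_iInf, Set.Finite.mem_toFinset,
        MulAction.mem_stabilizer_iff]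
      refine and_congr_left fun hg => ⟨fun h y hy => hmove hg hy ?_, fun h => ?_⟩
      · rw [← h, val_smul]
        simpa using hy
      · apply val_injective n
        rw [val_smul]
        refine Prod.ext (hL hg) (Set.ext fun y => ⟨fun hy => ?_, fun hy => ?_⟩)
        · have := h _ hy
          rw [smul_inv_smul] at this
          rw [this]
          exact hy
        · change g⁻¹ • y ∈ (val n p).2
          rwa [inv_smul_eq_iff.mpr (h y hy).symm]
    rw [key]
    refine Ta.rel_iInf_of_rel _ _ fun y hy => ?_
    have h := Ta.inter L (hY y)
    rwa [inf_eq_right.mpr (hfix _ (hp₁ y ((Set.Finite.mem_toFinset _).mp hy)))] at h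
  -- Some `s` in the fibre is moved by `L`, so `B = Gₛ ⊓ L` is a proper subgroup of `L` with `B → L`
  -- in `Tm`. The induction hypothesis for `B` is exactly what compatibility needs for `A = L` and
  -- `C = Gₚ ⊓ L`.
  · push Not at hfix
    obtain ⟨s, hs, hsL⟩ := hfix
    have hlt : MulAction.stabilizer G s ⊓ L < L :=
      lt_of_le_of_ne inf_le_right fun e => hsL (inf_eq_right.mp e)
    have hB := Tm.inter L (hn s)
    rw [hs, inf_eq_right.mpr hL] at hB
    refine hc.2 L _ _ inf_le_right inf_le_right hB ?_
    have h := ih _ hlt (inf_le_right.trans hL)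
    rwa [← inf_inf_distrib_right, inf_comm (MulAction.stabilizer G s), inf_assoc]

/-! ### A section with prescribed stabilizer -/

/-- The finite `G`-set `G/(B ∩ C) ⊔ G/B` over `G/B`. -/
def testObject (B C : Subgroup G) : Over (orbit B) :=
  Over.mk (Y := of (G := G) ((G ⧸ (B ⊓ C : Subgroup G)) ⊕ (G ⧸ B)))
    (homMk (Sum.elim (Subgroup.quotientMapOfLE inf_le_left) id) (by
      rintro g (⟨⟨x⟩⟩ | ⟨⟨x⟩⟩) <;> rfl))

/-- The section of `testObject B C` over `A/B` with values in `G/(B ∩ C)` on `CB/B` and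
in `G/B` elsewhere. -/
def testSet (A B C : Subgroup G) : Set (testObject B C).left.V :=
  {y | (∃ c ∈ C, y = Sum.inl (c : G ⧸ (B ⊓ C : Subgroup G))) ∨
    ∃ a ∈ A, (∀ c ∈ C, (c : G ⧸ B) ≠ a) ∧ y = Sum.inr (a : G ⧸ B)}

/-- The map `C/(B ∩ C) → CB/B` is a bijection, which gives unique lifts on `CB/B`; the summand `G/B`
supplies the lifts over the rest of `A/B`. -/
theorem isSection_testSet {A B C : Subgroup G} (hB : B ≤ A) (hC : C ≤ A) :
    IsSection (orbitMap hB) (testObject B C)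
      (show (orbit A).V from ((1 : G) : G ⧸ A), testSet A B C) := by
  have hA {a : G} (ha : a ∈ A) : (a : G ⧸ A) = ((1 : G) : G ⧸ A) :=
    (QuotientGroup.eq.mpr (by simpa using ha)).symm
  refine ⟨?_, ?_⟩
  · rintro _ (⟨c, hc, rfl⟩ | ⟨a, ha, -, rfl⟩)
    · exact hA (hC hc)
    · exact hA ha
  · rintro ⟨x⟩ hx
    have hx' : x ∈ A := by simpa using QuotientGroup.eq.mp (Eq.symm hx)
    by_cases h : ∃ c ∈ C, (c : G ⧸ B) = x
    · obtain ⟨c, hc, hcx⟩ := h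
      refine ⟨Sum.inl (c : G ⧸ (B ⊓ C : Subgroup G)), ⟨Or.inl ⟨c, hc, rfl⟩, hcx⟩, ?_⟩
      rintro _ ⟨⟨c', hc', rfl⟩ | ⟨a, -, ha, rfl⟩, hs⟩
      · have hs' : (c' : G ⧸ B) = x := hs
        exact congrArg Sum.inl (QuotientGroup.eq.mpr
          ⟨QuotientGroup.eq.mp (hs'.trans hcx.symm), C.mul_mem (C.inv_mem hc') hc⟩)
      · exact absurd (hcx.trans (Eq.symm hs)) (ha c hc)
    · push Not at h
      refine ⟨Sum.inr (x : G ⧸ B), ⟨Or.inr ⟨x, hx', h, rfl⟩, rfl⟩, ?_⟩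
      rintro _ ⟨⟨c, hc, rfl⟩ | ⟨a, -, ha, rfl⟩, hs⟩
      · exact absurd hs (h c hc)
      · exact congrArg Sum.inr hs

theorem smul_mem_testSet {A B C : Subgroup G} (hC : C ≤ A) {g : G} (hg : g ∈ C)
    {y : (testObject B C).left.V} (hy : y ∈ testSet A B C) : g • y ∈ testSet A B C := by
  rcases hy with ⟨c, hc, rfl⟩ | ⟨a, ha, hne, rfl⟩
  · exact Or.inl ⟨g * c, C.mul_mem hg hc, rfl⟩
  · refine Or.inr ⟨g * a, A.mul_mem (hC hg) ha, fun c hc h => ?_, rfl⟩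
    refine hne (g⁻¹ * c) (C.mul_mem (C.inv_mem hg) hc) ?_
    rw [QuotientGroup.eq] at h ⊢
    simpa [mul_assoc] using h

theorem stabilizer_testSet {A B C : Subgroup G} (hB : B ≤ A) (hC : C ≤ A)
    (p : (sectionsOver (orbitMap hB) (testObject B C)).left.V)
    (hp : val (orbitMap hB) p = (show (orbit A).V from ((1 : G) : G ⧸ A), testSet A B C)) :
    MulAction.stabilizer G p = C := by
  ext g
  rw [MulAction.mem_stabilizer_iff]
  constructor
  · intro h
    have h₁ : (val (orbitMap hB) (g • p)).2 = testSet A B C := by rw [h, hp]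
    rw [val_smul, hp] at h₁
    -- If `g` fixes the set, it moves the trivial coset in the first summand to another point of the
    -- set, and those points in that summand are cosets of elements of `C`.
    have h₂ : (show (testObject B C).left.V from Sum.inl (g : G ⧸ (B ⊓ C : Subgroup G))) ∈
        testSet A B C := by
      rw [← h₁]
      refine Or.inl ⟨1, C.one_mem, ?_⟩
      exact congrArg (fun x : G => Sum.inl (x : G ⧸ (B ⊓ C : Subgroup G))) (inv_mul_cancel g)
    rcases h₂ with ⟨c, hc, h₃⟩ | ⟨a, -, -, h₃⟩
    · have h₄ := QuotientGroup.eq.mp (Sum.inl_injective h₃)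
      have := C.mul_mem hc (C.inv_mem h₄.2)
      simpa using this
    · exact absurd h₃ (by rintro ⟨⟩)
  · intro hg
    apply val_injective (orbitMap hB)
    rw [val_smul, hp]
    refine Prod.ext ?_ (Set.ext fun y => ⟨fun hy => ?_, fun hy => ?_⟩)
    · exact (QuotientGroup.eq.mpr (by simpa using hC hg)).symm
    · have := smul_mem_testSet hC hg hy
      rwa [smul_inv_smul] at this
    · exact smul_mem_testSet hC (C.inv_mem hg) hy

end FinGSet

/-! ### The two implications -/

namespace IndexingCategory

open FinGSet

variable {G : Type u} [Group G] [Finite G]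

/-- Stabilizers along an orbit are conjugate, so admissibility need only be checked at one point per
orbit. -/
theorem admissible_stabilizer_smul (O : IndexingCategory G) {X Y : FinGSet G} (f : X ⟶ Y) (g : G)
    {x : X.V} (h : O.Admissible (MulAction.stabilizer G x) (MulAction.stabilizer G (f.hom x))) :
    O.Admissible (MulAction.stabilizer G (g • x)) (MulAction.stabilizer G (f.hom (g • x))) := by
  rw [hom_smul, MulAction.stabilizer_smul_eq_stabilizer_map_conj,
    MulAction.stabilizer_smul_eq_stabilizer_map_conj]
  exact O.transferSystem.conj g h

/-- At the base points of the two orbits the stabilizer pairs are `(B ⊓ C, B)` and `(B, B)`. -/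
theorem hom_testObject (O : IndexingCategory G) {B C : Subgroup G}
    (h : O.Admissible (B ⊓ C) B) : O.hom (testObject B C).hom := by
  rw [hom_iff_stabilizer]
  have hB : MulAction.stabilizer G (show (orbit B).V from ((1 : G) : G ⧸ B)) = B :=
    stabilizer_orbit_one B
  rintro (⟨⟨x⟩⟩ | ⟨⟨x⟩⟩)
  · let y : (testObject B C).left.V := Sum.inl ((1 : G) : G ⧸ (B ⊓ C : Subgroup G))
    have hy : (testObject B C).hom.hom y = (show (orbit B).V from ((1 : G) : G ⧸ B)) := rfl
    have hxy : (show (testObject B C).left.V from Sum.inl (x : G ⧸ (B ⊓ C : Subgroup G))) =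
        x • y :=
      congrArg (fun z : G => Sum.inl (z : G ⧸ (B ⊓ C : Subgroup G))) (mul_one x).symm
    have hs : MulAction.stabilizer G y = B ⊓ C := by
      refine Eq.trans ?_ (stabilizer_orbit_one (B ⊓ C))
      ext g
      exact Sum.inl_injective.eq_iff (a := g • ((1 : G) : G ⧸ (B ⊓ C : Subgroup G)))
    have := O.admissible_stabilizer_smul (testObject B C).hom x (x := y) (by rwa [hy, hs, hB])
    rwa [← hxy] at this
  · let y : (testObject B C).left.V := Sum.inr ((1 : G) : G ⧸ B)
    have hy : (testObject B C).hom.hom y = (show (orbit B).V from ((1 : G) : G ⧸ B)) := rfl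
    have hxy : (show (testObject B C).left.V from Sum.inr (x : G ⧸ B)) = x • y :=
      congrArg (fun z : G => Sum.inr (z : G ⧸ B)) (mul_one x).symm
    have hs : MulAction.stabilizer G y = B := by
      refine Eq.trans ?_ (stabilizer_orbit_one B)
      ext g
      exact Sum.inr_injective.eq_iff (a := g • ((1 : G) : G ⧸ B))
    have := O.admissible_stabilizer_smul (testObject B C).hom x (x := y)
      (by rw [hy, hs, hB]; exact O.transferSystem.refl B)
    rwa [← hxy] at this

theorem Compatible.transferSystem {Om Oa : IndexingCategory G} (hc : Om.Compatible Oa) :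
    Om.transferSystem.Compatible Oa.transferSystem := by
  have key (A B C : Subgroup G) (hC : C ≤ A) (hBA : Om.transferSystem.rel B A)
      (h : Oa.transferSystem.rel (B ⊓ C) B) : Oa.transferSystem.rel C A := by
    obtain ⟨hB, hn⟩ := hBA
    have hs := (Oa.hom_dependentProduct_iff _ _).mp (hc _ hn _ (Oa.hom_testObject h))
    rw [hom_iff_stabilizer] at hs
    let p : Sections (orbitMap hB) (testObject B C) := ⟨_, isSection_testSet hB hC⟩
    have hp : Oa.Admissible
        (MulAction.stabilizer G (show (sectionsOver (orbitMap hB) (testObject B C)).left.V from p))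
        (MulAction.stabilizer G (show (orbit A).V from ((1 : G) : G ⧸ A))) := hs p
    have e₁ := stabilizer_testSet hB hC p rfl
    have e₂ := stabilizer_orbit_one A
    dsimp only at e₁ e₂ hp
    rwa [e₁, e₂] at hp
  refine ⟨fun K H h => ?_, fun A B C _ hC hBA h => key A B C hC hBA h⟩
  -- With `B = C = K` the hypothesis on `B ⊓ C` is reflexivity, so `Tm ≤ Ta` is a special case of
  -- the second condition.
  refine key H K K h.1 h ?_
  rw [inf_idem]
  exact Oa.transferSystem.refl K

theorem compatible_of_transferSystem {Om Oa : IndexingCategory G}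
    (hc : Om.transferSystem.Compatible Oa.transferSystem) : Om.Compatible Oa := by
  intro S T n hn Y hY
  rw [hom_dependentProduct_iff, hom_iff_stabilizer]
  intro p
  have h := rel_stabilizer_section_inf n Y hc ((Om.hom_iff_stabilizer n).mp hn)
    ((Oa.hom_iff_stabilizer Y.hom).mp hY) p _ le_rfl
  have hle : MulAction.stabilizer G p ≤ MulAction.stabilizer G (val n p).1 :=
    stabilizer_le_of_hom (sectionsOver n Y).hom p
  rwa [inf_eq_left.mpr hle] at h

end IndexingCategory

theorem theorem4 {G : Type u} [Group G] [Finite G] (Om Oa : IndexingCategory G) :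
    Om.Compatible Oa ↔ Om.transferSystem.Compatible Oa.transferSystem :=
  ⟨IndexingCategory.Compatible.transferSystem, IndexingCategory.compatible_of_transferSystem⟩
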